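/- Let $k\ge 1$, let $\|\cdot\|$ be an arbitrary norm on $\mathbb R^k$, and let $\{X_t\}_{t\in\mathbb Z}$ be a strictly stationary sequence in $\mathbb R^p$ with marginal distribution $F$. Let $T$ be an $\mathbb R^k$-valued functional of distributions on $\mathbb R^p$. Assume that the influence function $IF(x;F)=\lim_{\epsilon\downarrow 0}\epsilon^{-1}\{T((1-\epsilon)F+\epsilon\delta_x)-T(F)\}$ exists for $F$-almost every $x$. For $j,l\ge1$ let $\rho_{j,j+l-1}=l^{-1}\sum_{h=j}^{j+l-1}\delta_{X_h}$ be the empirical distribution of a block, put $\hat\theta_{j,j+l-1}=T(\rho_{j,j+l-1})$ and $\hat\theta_n=\hat\theta_{1,n}$ (assumed to be random vectors), and define the remainders $R_{j,j+l-1}$ by $$T(\rho_{j,j+l-1})=T(F)+l^{-1}\sum_{h=j}^{j+l-1}IF(X_h;F)+R_{j,j+l-1}.$$ Let $b\in(0,1]$ be fixed, let the block lengths $l=l_n\le n$ satisfy $l_n/n\to b$, and put $N=n-l+1$. Assume: (A.1) $\mathbb E\{IF(X_j;F)\}=0$, and $n^{-1/2}\sum_{j=1}^{\lfloor nr\rfloor}IF(X_j;F)\Rightarrow\Sigma^{1/2}W_k(r)$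 weakly in the space $D([0,1];\mathbb R^k)$ of càdlàg functions with the Skorokhod topology. Here $\Sigma$ is a positive definite matrix and $W_k$ is a vector of $k$ independent standard Brownian motions. (A.2) $\sqrt n\,\|R_{1,n}\|=o_p(1)$ and $\sqrt l\,\sup_{1\le j\le N}\|R_{j,j+l-1}\|=o_p(1)$. Then under the null hypothesis $T(F)=\theta_0$ the subsampling p-value $$N^{-1}\sum_{j=1}^{N}\mathbf 1\{\|\sqrt n(\hat\theta_n-\theta_0)\|\le\|\sqrt l(\hat\theta_{j,j+l-1}-\hat\theta_n)\|\}$$ converges in distribution, as $n\to\infty$, to $$\widetilde G(b;k)=(1-b)^{-1}\int_0^{1-b}\mathbf 1\left\{\|\Sigma^{1/2}W_k(1)\|\le\|\Sigma^{1/2}(W_k(b+t)-W_k(t)-bW_k(1))\|/\sqrt b\right\}dt .$$ If $k=1$, then $\widetilde G(b;1)$ equals $$\widetilde G(b)=(1-b)^{-1}\int_0^{1-b}\mathbf 1\left\{|W(1)|\le|W(b+t)-W(t)-bW(1)|/\sqrt b\right\}dt$$ with $W=W_1$, a standard Brownian motion, so the limit is pivotal for given $b$. For $b=1$ the averages $(1-b)^{-1}\int_0^{1-b}f(t)\,dt$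 are read as $f(0)$. -/

import Mathlib

open MeasureTheory ProbabilityTheory Filter Topology
open scoped NNReal ENNReal Matrix unitInterval MatrixOrder

noncomputable section

/-! ### The Skorokhod space of `E`-valued càdlàg functions on `[0,1]` -/

/-- Right continuous on `[0,1]`, with left limits. -/
def IsCadlag {E : Type*} [TopologicalSpace E] (x : I → E) : Prop :=
  ∀ t : I, ContinuousWithinAt x (Set.Ici t) t ∧ ∃ y : E, Tendsto x (𝓝[<] t) (𝓝 y)

/-- The space `D([0,1]; E)`. -/
def SkorokhodSpace (E : Type*) [TopologicalSpace E] : Type _ := {x : I → E // IsCadlag x}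

/-- `y` lies in the Skorokhod ball of radius `ε` around `x`: there is an increasing bijection `τ` of
`[0,1]` within `ε` of the identity such that `y ∘ τ` is within `ε` of `x`. -/
def SkorokhodClose {E : Type*} [PseudoMetricSpace E] (ε : ℝ) (x y : SkorokhodSpace E) : Prop :=
  ∃ τ : I ≃o I, (∀ t : I, |((τ t : I) : ℝ) - (t : ℝ)| < ε) ∧ ∀ t : I, dist (x.1 t) (y.1 (τ t)) < ε

/-- The Skorokhod (`J₁`) topology: the open sets are those containing a Skorokhod ball around each
of their points. -/
instance {E : Type*} [PseudoMetricSpace E] : TopologicalSpace (SkorokhodSpace E) where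
  IsOpen U := ∀ x ∈ U, ∃ ε : ℝ, 0 < ε ∧ ∀ y, SkorokhodClose ε x y → y ∈ U
  isOpen_univ := fun _ _ => ⟨1, one_pos, fun _ _ => trivial⟩
  isOpen_inter := by
    rintro U V hU hV x ⟨hxU, hxV⟩
    obtain ⟨ε, hε, h⟩ := hU x hxU
    obtain ⟨δ, hδ, h'⟩ := hV x hxV
    refine ⟨min ε δ, lt_min hε hδ, fun y hy => ?_⟩
    obtain ⟨τ, h1, h2⟩ := hy
    exact ⟨h y ⟨τ, fun t => (h1 t).trans_le (min_le_left _ _),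
        fun t => (h2 t).trans_le (min_le_left _ _)⟩,
      h' y ⟨τ, fun t => (h1 t).trans_le (min_le_right _ _),
        fun t => (h2 t).trans_le (min_le_right _ _)⟩⟩
  isOpen_sUnion := by
    rintro S hS x ⟨U, hU, hxU⟩
    obtain ⟨ε, hε, h⟩ := hS U hU x hxU
    exact ⟨ε, hε, fun y hy => ⟨U, hU, h y hy⟩⟩

/-- The Borel σ-algebra of the Skorokhod topology. -/
instance {E : Type*} [PseudoMetricSpace E] : MeasurableSpace (SkorokhodSpace E) := borel _

instance {E : Type*} [PseudoMetricSpace E] : BorelSpace (SkorokhodSpace E) := ⟨rfl⟩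

theorem isCadlag_of_continuous {E : Type*} [TopologicalSpace E] {x : I → E} (hx : Continuous x) :
    IsCadlag x :=
  fun t => ⟨hx.continuousWithinAt, x t, (hx.tendsto t).mono_left nhdsWithin_le_nhds⟩

theorem isCadlag_comp_floor {E : Type*} [TopologicalSpace E] (n : ℕ) (s : ℕ → E) :
    IsCadlag (fun r : I => s ⌊(n : ℝ) * (r : ℝ)⌋₊) := by
  rcases Nat.eq_zero_or_pos n with rfl | hn
  · simpa using isCadlag_of_continuous (E := E) (x := fun _ : I => s 0) continuous_const
  have hn' : (0 : ℝ) < n := by exact_mod_cast hn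
  have hc : Continuous (fun r : I => (n : ℝ) * (r : ℝ)) := by fun_prop
  intro t
  constructor
  · have h1 : Tendsto (fun r : I => (n : ℝ) * (r : ℝ)) (𝓝[≥] t) (𝓝[≥] ((n : ℝ) * (t : ℝ))) := by
      refine tendsto_nhdsWithin_iff.2 ⟨(hc.tendsto t).mono_left nhdsWithin_le_nhds, ?_⟩
      filter_upwards [self_mem_nhdsWithin] with r hr
      exact mul_le_mul_of_nonneg_left (show (t : ℝ) ≤ r from hr) hn'.le
    have h2 := (tendsto_floor_right_pure_floor ((n : ℝ) * (t : ℝ))).comp h1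
    have h3 : ∀ᶠ r : I in 𝓝[≥] t, ⌊(n : ℝ) * (r : ℝ)⌋ = ⌊(n : ℝ) * (t : ℝ)⌋ := tendsto_pure.1 h2
    refine Tendsto.congr' ?_ tendsto_const_nhds
    filter_upwards [h3] with r hr
    simp only [← Int.floor_toNat, hr]
  · have h1 : Tendsto (fun r : I => (n : ℝ) * (r : ℝ)) (𝓝[<] t) (𝓝[<] ((n : ℝ) * (t : ℝ))) := by
      refine tendsto_nhdsWithin_iff.2 ⟨(hc.tendsto t).mono_left nhdsWithin_le_nhds, ?_⟩
      filter_upwards [self_mem_nhdsWithin] with r hr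
      exact mul_lt_mul_of_pos_left (show (r : ℝ) < t from hr) hn'
    have h2 := (tendsto_floor_left_pure_ceil_sub_one ((n : ℝ) * (t : ℝ))).comp h1
    have h3 : ∀ᶠ r : I in 𝓝[<] t, ⌊(n : ℝ) * (r : ℝ)⌋ = ⌈(n : ℝ) * (t : ℝ)⌉ - 1 :=
      tendsto_pure.1 h2
    refine ⟨s (⌈(n : ℝ) * (t : ℝ)⌉ - 1).toNat, Tendsto.congr' ?_ tendsto_const_nhds⟩
    filter_upwards [h3] with r hr
    simp only [← Int.floor_toNat, hr]

/-- The normalized partial sum process `r ↦ n^{-1/2} ∑_{j=1}^{⌊nr⌋} Y_j` as an element of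
`D([0,1]; ℝᵏ)`. -/
def partialSumPath {k : ℕ} (Y : ℤ → (Fin k → ℝ)) (n : ℕ) : SkorokhodSpace (Fin k → ℝ) :=
  ⟨fun r : I => (Real.sqrt n)⁻¹ • ∑ j ∈ Finset.Icc 1 ⌊(n : ℝ) * (r : ℝ)⌋₊, Y (j : ℤ),
    isCadlag_comp_floor n (fun m => (Real.sqrt n)⁻¹ • ∑ j ∈ Finset.Icc 1 m, Y (j : ℤ))⟩

/-! ### Brownian motion -/

/-- `W = (W_1, …, W_k)` is a vector of independent standard real Brownian motions with continuous
paths. -/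
structure IsBrownianVector {k : ℕ} {Ω : Type*} [MeasurableSpace Ω] (W : Fin k → ℝ≥0 → Ω → ℝ)
    (Q : Measure Ω) : Prop where
  brownian : ∀ i, IsBrownianReal (W i) Q
  indep : iIndepFun (fun i ω t => W i t ω) Q
  cont : ∀ i ω, Continuous (fun t => W i t ω)

/-- The vector `Σ^{1/2} W_k(t)(ω)`, with the positive semidefinite square root of `Σ`. -/
def scaledBrownian {k : ℕ} {Ω : Type*} (S : Matrix (Fin k) (Fin k) ℝ) (W : Fin k → ℝ≥0 → Ω → ℝ)
    (ω : Ω) (t : ℝ≥0) : Fin k → ℝ :=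
  CFC.sqrt S *ᵥ (fun i => W i t ω)

/-- The path `r ↦ Σ^{1/2} W_k(r)` on `[0,1]` as an element of `D([0,1]; ℝᵏ)`. -/
def scaledBrownianPath {k : ℕ} {Ω : Type*} (S : Matrix (Fin k) (Fin k) ℝ)
    (W : Fin k → ℝ≥0 → Ω → ℝ) (hW : ∀ i ω, Continuous (fun t => W i t ω)) (ω : Ω) :
    SkorokhodSpace (Fin k → ℝ) :=
  ⟨fun r : I => scaledBrownian S W ω (r : ℝ).toNNReal, isCadlag_of_continuous (by
    have h : Continuous (fun r : I => fun i => W i (r : ℝ).toNNReal ω) :=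
      continuous_pi fun i => (hW i ω).comp (continuous_real_toNNReal.comp continuous_subtype_val)
    exact Continuous.matrix_mulVec continuous_const h)⟩

/-! ### The statistical functional and the subsampling p-value -/

/-- The law `P` of the sequence `X_t`, `t ∈ ℤ`, is invariant under time shifts. -/
def IsStationarySeq {Ω E : Type*} [MeasurableSpace Ω] [MeasurableSpace E] (X : ℤ → Ω → E)
    (P : Measure Ω) : Prop :=
  ∀ h : ℤ, IdentDistrib (fun ω (t : ℤ) => X (t + h) ω) (fun ω (t : ℤ) => X t ω) P P

/-- The empirical distribution `ρ_{j,j+l-1}` of `x_j, …, x_{j+l-1}`. -/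
def blockEmpirical {E : Type*} [MeasurableSpace E] (x : ℤ → E) (j l : ℕ) : Measure E :=
  (l : ℝ≥0∞)⁻¹ • ∑ h ∈ Finset.Ico j (j + l), Measure.dirac (x (h : ℤ))

/-- The difference quotient `(T((1-ε)F + εδ_x) - T(F)) / ε`. -/
def contaminationQuotient {E V : Type*} [MeasurableSpace E] [AddCommGroup V] [Module ℝ V]
    (T : Measure E → V) (F : Measure E) (x : E) (ε : ℝ) : V :=
  ε⁻¹ • (T (ENNReal.ofReal (1 - ε) • F + ENNReal.ofReal ε • Measure.dirac x) - T F)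

/-- The influence function `IF(x;F) = lim_{ε ↓ 0} (T((1-ε)F + εδ_x) - T(F)) / ε`. -/
def influenceFunction {E V : Type*} [MeasurableSpace E] [AddCommGroup V] [Module ℝ V]
    [TopologicalSpace V] [Nonempty V] (T : Measure E → V) (F : Measure E) (x : E) : V :=
  limUnder (𝓝[>] (0 : ℝ)) (contaminationQuotient T F x)

/-- The remainder `R_{j,j+l-1}` in the expansion
`T(ρ_{j,j+l-1}) = T(F) + l⁻¹ ∑_{h=j}^{j+l-1} IF(x_h;F) + R_{j,j+l-1}`. -/
def remainder {E V : Type*} [MeasurableSpace E] [AddCommGroup V] [Module ℝ V]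
    [TopologicalSpace V] (T : Measure E → V) (F : Measure E) (x : ℤ → E) (j l : ℕ) : V :=
  T (blockEmpirical x j l) - T F
    - (l : ℝ)⁻¹ • ∑ h ∈ Finset.Ico j (j + l), influenceFunction T F (x (h : ℤ))

open scoped Classical in
/-- The subsampling p-value
`N⁻¹ ∑_{j=1}^N 1(‖√n (θ̂_n - θ₀)‖ ≤ ‖√l (θ̂_{j,j+l-1} - θ̂_n)‖)`, `N = n - l + 1`. -/
def subsamplingPValue {E V : Type*} [MeasurableSpace E] [AddCommGroup V] [Module ℝ V]
    (ν : Seminorm ℝ V) (T : Measure E → V) (θ₀ : V) (x : ℤ → E) (n l : ℕ) : ℝ :=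
  ((n - l + 1 : ℕ) : ℝ)⁻¹ * ∑ j ∈ Finset.Icc 1 (n - l + 1),
    if ν (Real.sqrt n • (T (blockEmpirical x 1 n) - θ₀))
        ≤ ν (Real.sqrt l • (T (blockEmpirical x j l) - T (blockEmpirical x 1 n)))
      then (1 : ℝ) else 0

/-! ### The limiting variables -/

/-- The average `(1-b)⁻¹ ∫_0^{1-b} f(t) dt`, read as `f(0)` when `b = 1`. -/
def blockAverage (b : ℝ) (f : ℝ → ℝ) : ℝ :=
  open scoped Classical in if b = 1 then f 0 else (1 - b)⁻¹ * ∫ t in (0 : ℝ)..(1 - b), f t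

open scoped Classical in
/-- The random variable `G̃(b;k)` built from `W_k`, `Σ` and the norm `ν`. -/
def gTildeVec {k : ℕ} {Ω : Type*} (b : ℝ) (S : Matrix (Fin k) (Fin k) ℝ)
    (ν : Seminorm ℝ (Fin k → ℝ)) (W : Fin k → ℝ≥0 → Ω → ℝ) (ω : Ω) : ℝ :=
  blockAverage b fun t =>
    if ν (CFC.sqrt S *ᵥ (fun i => W i 1 ω))
        ≤ ν (CFC.sqrt S *ᵥ
            (fun i => W i (b + t).toNNReal ω - W i t.toNNReal ω - b * W i 1 ω)) / Real.sqrt b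
      then 1 else 0

open scoped Classical in
/-- The random variable `G̃(b)` built from one real Brownian motion `B`. -/
def gTilde {Ω : Type*} (b : ℝ) (B : ℝ≥0 → Ω → ℝ) (ω : Ω) : ℝ :=
  blockAverage b fun t =>
    if |B 1 ω| ≤ |B (b + t).toNNReal ω - B t.toNNReal ω - b * B 1 ω| / Real.sqrt b
      then 1 else 0

end

/-!
The p-value is the proportion of blocks whose statistic is at least the full-sample statistic. By
the expansion of `T`, both statistics are, up to the remainders, fixed functions of the partial sum
path `S_n` at the times `1`, `j / n` and `(j + l) / n` (`abs_estimate_sub_le`,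
`abs_block_sub_blockStat_le`). The p-value is a discontinuous function of `S_n` that also varies
with `n`, so the ordinary continuous mapping theorem does not apply.

Instead, `tendstoInDistribution_of_relation` transfers convergence in distribution from `S_n` to the
p-value through the closed-set form of the portmanteau theorem: it is enough that every limit, along
paths converging to `w`, sample sizes tending to infinity and errors tending to zero, of such
proportions equals the value of the limiting functional at `w`, for almost every limiting path `w`.
The portmanteau theorem applies because the Skorokhod topology is pseudometrizable.

For a continuous path `w` this limit is computed by dominated convergence (`tendsto_proportion`),
after both the sum over blocks and the average over windows are written as integrals over `[0,1]`;
the indicators converge at every time at which the two statistics of `w` do not tie. That ties occur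
on a null set of times for almost every path follows from Fubini's theorem: at a fixed time, the
endpoint `W(1)` is independent of the bridge increment `W(b+t) - W(t) - b W(1)`, with which it is
jointly Gaussian and uncorrelated, and its law gives no mass to spheres of a norm
(`IsBrownianVector.ae_ne_bridge`).
-/

/-! ### Metrizability of the Skorokhod space -/

theorem SkorokhodClose.refl {E : Type*} [PseudoMetricSpace E] {ε : ℝ} (hε : 0 < ε)
    (x : SkorokhodSpace E) : SkorokhodClose ε x x :=
  ⟨OrderIso.refl _, fun t => by simpa using hε, fun t => by simpa using hε⟩

theorem SkorokhodClose.symm {E : Type*} [PseudoMetricSpace E] {ε : ℝ} {x y : SkorokhodSpace E}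
    (h : SkorokhodClose ε x y) : SkorokhodClose ε y x := by
  obtain ⟨τ, h1, h2⟩ := h
  refine ⟨τ.symm, fun t => ?_, fun t => ?_⟩
  · have := h1 (τ.symm t)
    rwa [OrderIso.apply_symm_apply, abs_sub_comm] at this
  · have := h2 (τ.symm t)
    rwa [OrderIso.apply_symm_apply, dist_comm] at this

theorem SkorokhodClose.trans {E : Type*} [PseudoMetricSpace E] {ε δ : ℝ}
    {x y z : SkorokhodSpace E} (h : SkorokhodClose ε x y) (h' : SkorokhodClose δ y z) :
    SkorokhodClose (ε + δ) x z := by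
  obtain ⟨τ, h1, h2⟩ := h
  obtain ⟨τ', h3, h4⟩ := h'
  refine ⟨τ.trans τ', fun t => ?_, fun t => ?_⟩
  · have := abs_sub_le ((τ' (τ t) : I) : ℝ) (τ t : I) t
    have := h1 t
    have := h3 (τ t)
    rw [OrderIso.trans_apply]
    linarith
  · have := dist_triangle (x.1 t) (y.1 (τ t)) (z.1 (τ' (τ t)))
    have := h2 t
    have := h4 (τ t)
    rw [OrderIso.trans_apply]
    linarith

theorem SkorokhodClose.mono {E : Type*} [PseudoMetricSpace E] {ε δ : ℝ}
    {x y : SkorokhodSpace E} (h : SkorokhodClose ε x y) (hεδ : ε ≤ δ) : SkorokhodClose δ x y := by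
  obtain ⟨τ, h1, h2⟩ := h
  exact ⟨τ, fun t => (h1 t).trans_le hεδ, fun t => (h2 t).trans_le hεδ⟩

theorem skorokhod_nhds_basis {E : Type*} [PseudoMetricSpace E] (x : SkorokhodSpace E) :
    (𝓝 x).HasBasis (fun ε : ℝ => 0 < ε) (fun ε => {y | SkorokhodClose ε x y}) := by
  refine ⟨fun s => ⟨fun hs => ?_, ?_⟩⟩
  · obtain ⟨U, hU, hUo, hx⟩ := mem_nhds_iff.1 hs
    obtain ⟨ε, hε, h⟩ := hUo x hx
    exact ⟨ε, hε, fun y hy => hU (h y hy)⟩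
  · rintro ⟨ε, hε, h⟩
    -- The ball of radius `ε` need not be open; the union of the smaller concentric balls is.
    refine mem_nhds_iff.2 ⟨{y | ∃ δ < ε, SkorokhodClose δ x y}, ?_, ?_, ε / 2, by linarith,
      SkorokhodClose.refl (by linarith) x⟩
    · rintro y ⟨δ, hδ, hy⟩
      exact h (hy.mono hδ.le)
    · rintro y ⟨δ, hδ, hy⟩
      exact ⟨(ε - δ) / 2, by linarith, fun z hz => ⟨δ + (ε - δ) / 2, by linarith, hy.trans hz⟩⟩

theorem skorokhod_entourage_basis (E : Type*) [PseudoMetricSpace E] :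
    (⨅ ε ∈ Set.Ioi (0 : ℝ), 𝓟 {p : SkorokhodSpace E × SkorokhodSpace E |
      SkorokhodClose ε p.1 p.2}).HasBasis (fun ε : ℝ => 0 < ε)
        (fun ε => {p | SkorokhodClose ε p.1 p.2}) := by
  refine hasBasis_biInf_principal (S := Set.Ioi (0 : ℝ)) ?_ ⟨1, one_pos (α := ℝ)⟩
  intro ε hε δ hδ
  exact ⟨min ε δ, lt_min (α := ℝ) hε hδ, fun p hp => SkorokhodClose.mono hp (min_le_left _ _),
    fun p hp => SkorokhodClose.mono hp (min_le_right _ _)⟩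

/-- The uniform structure whose entourages are generated by the relations `SkorokhodClose ε`. It
induces the Skorokhod topology. -/
abbrev skorokhodUniformSpace (E : Type*) [PseudoMetricSpace E] :
    UniformSpace (SkorokhodSpace E) where
  uniformity := ⨅ ε ∈ Set.Ioi (0 : ℝ), 𝓟 {p | SkorokhodClose ε p.1 p.2}
  symm := (skorokhod_entourage_basis E).tendsto_iff (skorokhod_entourage_basis E) |>.2
    fun ε hε => ⟨ε, hε, fun p hp => SkorokhodClose.symm hp⟩
  comp := by
    have hb := skorokhod_entourage_basis E
    refine ((hb.lift' (monotone_id.relComp monotone_id)).le_basis_iff hb).2 fun ε hε =>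
      ⟨ε / 2, half_pos hε, ?_⟩
    rintro ⟨x, z⟩ ⟨y, h1, h2⟩
    exact (SkorokhodClose.trans h1 h2).mono (by simp)
  nhds_eq_comap_uniformity := fun x =>
    (skorokhod_nhds_basis x).eq_of_same_basis ((skorokhod_entourage_basis E).comap (Prod.mk x))

/-- Metrizability makes the portmanteau theorem available on the Skorokhod space. -/
instance {E : Type*} [PseudoMetricSpace E] :
    TopologicalSpace.PseudoMetrizableSpace (SkorokhodSpace E) := by
  let _ := skorokhodUniformSpace E
  have hb : (uniformity (SkorokhodSpace E)).HasBasis (fun _ : ℕ => True)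
      (fun m => {p | SkorokhodClose (1 / ((m : ℝ) + 1)) p.1 p.2}) := by
    refine (skorokhod_entourage_basis E).to_hasBasis (fun ε hε => ?_)
      (fun m _ => ⟨1 / ((m : ℝ) + 1), by positivity, subset_rfl⟩)
    obtain ⟨m, hm⟩ := exists_nat_one_div_lt hε
    exact ⟨m, trivial, fun p hp => SkorokhodClose.mono hp hm.le⟩
  have := hb.isCountablyGenerated
  exact UniformSpace.pseudoMetrizableSpace

/-- Skorokhod convergence to a continuous path is locally uniform, so that evaluation may take
place at converging times. -/
theorem tendsto_eval_of_skorokhodClose {E ι : Type*} [PseudoMetricSpace E] {L : Filter ι}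
    {x : SkorokhodSpace E} (hx : Continuous x.1) {y : ι → SkorokhodSpace E} {ε : ι → ℝ}
    (hε : Tendsto ε L (𝓝 0)) (hxy : ∀ m, SkorokhodClose (ε m) x (y m)) {r : ι → I} {r₀ : I}
    (hr : Tendsto r L (𝓝 r₀)) : Tendsto (fun m => (y m).1 (r m)) L (𝓝 (x.1 r₀)) := by
  choose τ h1 h2 using hxy
  have h3 : Tendsto (fun m => dist ((τ m).symm (r m)) (r m)) L (𝓝 0) := by
    refine squeeze_zero (fun _ => dist_nonneg) (fun m => ?_) hε
    have := h1 m ((τ m).symm (r m))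
    rw [OrderIso.apply_symm_apply] at this
    rw [dist_comm]
    exact this.le
  have h4 : Tendsto (fun m => (τ m).symm (r m)) L (𝓝 r₀) := by
    refine (tendsto_iff_of_dist h3).2 hr
  refine (tendsto_iff_of_dist (squeeze_zero (fun _ => dist_nonneg) (fun m => ?_) hε)).1
    ((hx.tendsto r₀).comp h4)
  have := h2 m ((τ m).symm (r m))
  rw [OrderIso.apply_symm_apply] at this
  exact this.le

/-! ### Proportions of blocks along converging paths -/

/-- The value of a path at a real time, constant outside `[0,1]`. -/
noncomputable def SkorokhodSpace.eval {E : Type*} [TopologicalSpace E] (w : SkorokhodSpace E)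
    (r : ℝ) : E :=
  w.1 (Set.projIcc 0 1 zero_le_one r)

theorem average_eq_integral_floor (N : ℕ) (hN : 0 < N) (g : ℕ → ℝ) :
    (N : ℝ)⁻¹ * ∑ j ∈ Finset.range N, g j = ∫ s in (0 : ℝ)..1, g ⌊(N : ℝ) * s⌋₊ := by
  have hN' : (N : ℝ) ≠ 0 := by exact_mod_cast hN.ne'
  rw [intervalIntegral.integral_comp_mul_left (fun x => g ⌊x⌋₊) hN', mul_zero, mul_one,
    smul_eq_mul]
  have hfl : ∀ j : ℕ, ∀ x ∈ Set.uIoo (j : ℝ) ((j + 1 : ℕ) : ℝ), g j = g ⌊x⌋₊ := by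
    intro j x hx
    rw [Set.uIoo_of_le (by simp)] at hx
    rw [(Nat.floor_eq_iff (by linarith [hx.1, (Nat.cast_nonneg j : (0 : ℝ) ≤ j)])).2
      ⟨hx.1.le, by exact_mod_cast hx.2⟩]
  have hint : ∀ j : ℕ,
      IntervalIntegrable (fun x : ℝ => g ⌊x⌋₊) volume (j : ℝ) ((j + 1 : ℕ) : ℝ) := fun j =>
    (intervalIntegrable_const (c := g j)).congr_uIoo (hfl j)
  have hsum := intervalIntegral.sum_integral_adjacent_intervals
    (a := fun j : ℕ => (j : ℝ)) (n := N) (f := fun x : ℝ => g ⌊x⌋₊) (μ := volume)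
    fun j _ => hint j
  rw [Nat.cast_zero] at hsum
  rw [← hsum]
  congr 1
  refine Finset.sum_congr rfl fun j _ => ?_
  rw [← intervalIntegral.integral_congr_uIoo (hfl j)]
  simp

/-- This form of the average covers the convention for `b = 1` without a case distinction. -/
theorem blockAverage_eq_integral {b : ℝ} (f : ℝ → ℝ) :
    blockAverage b f = ∫ s in (0 : ℝ)..1, f ((1 - b) * s) := by
  unfold blockAverage
  split_ifs with h
  · simp [h]
  · rw [intervalIntegral.integral_comp_mul_left f (sub_ne_zero.2 (Ne.symm h))]
    simp

/-- The norm of the centred and scaled increment of the path over the block of length `l` that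
starts after index `j`, in a sample of size `n`. -/
noncomputable def blockStat {V : Type*} [NormedAddCommGroup V] [NormedSpace ℝ V]
    (ν : Seminorm ℝ V) (n l : ℕ) (w : SkorokhodSpace V) (j : ℕ) : ℝ :=
  ν ((√(n : ℝ) / √(l : ℝ)) •
    (w.eval (((j + l : ℕ) : ℝ) / n) - w.eval ((j : ℝ) / n) - ((l : ℝ) / n) • w.1 1))

/-- The continuous-time counterpart of `blockStat`, for the window `[t, t + b]`. -/
noncomputable def windowStat {V : Type*} [NormedAddCommGroup V] [NormedSpace ℝ V]
    (ν : Seminorm ℝ V) (b : ℝ) (w : SkorokhodSpace V) (t : ℝ) : ℝ :=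
  ν (w.eval (b + t) - w.eval t - b • w.1 1) / √b

theorem tendsto_blockStat {V : Type*} [NormedAddCommGroup V] [NormedSpace ℝ V]
    {ν : Seminorm ℝ V} (hν : Continuous ν) {b : ℝ} (hb0 : 0 < b) {l : ℕ → ℕ}
    (hlb : Tendsto (fun n : ℕ => (l n : ℝ) / (n : ℝ)) atTop (𝓝 b))
    {x : SkorokhodSpace V} (hx : Continuous x.1) {ι : Type*} {L : Filter ι}
    {y : ι → SkorokhodSpace V} {ε : ι → ℝ} (hε : Tendsto ε L (𝓝 0))
    (hxy : ∀ m, SkorokhodClose (ε m) x (y m)) {n : ι → ℕ} (hn : Tendsto n L atTop)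
    {j : ι → ℕ} {t : ℝ} (hj : Tendsto (fun m => (j m : ℝ) / n m) L (𝓝 t)) :
    Tendsto (fun m => blockStat ν (n m) (l (n m)) (y m) (j m)) L (𝓝 (windowStat ν b x t)) := by
  have hev : ∀ {r : ι → ℝ} {r₀ : ℝ}, Tendsto r L (𝓝 r₀) →
      Tendsto (fun m => (y m).eval (r m)) L (𝓝 (x.eval r₀)) := fun hr =>
    tendsto_eval_of_skorokhodClose hx hε hxy ((continuous_projIcc.tendsto _).comp hr)
  have h1 : Tendsto (fun m => (y m).1 1) L (𝓝 (x.1 1)) :=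
    tendsto_eval_of_skorokhodClose hx hε hxy tendsto_const_nhds
  have hln : Tendsto (fun m => (l (n m) : ℝ) / n m) L (𝓝 b) := hlb.comp hn
  have h2 : Tendsto (fun m => (((j m + l (n m) : ℕ) : ℝ)) / n m) L (𝓝 (b + t)) := by
    refine (hln.add hj).congr fun m => ?_
    push_cast
    ring
  have h3 : Tendsto (fun m => √(n m : ℝ) / √(l (n m) : ℝ)) L (𝓝 ((√b)⁻¹)) := by
    refine ((hln.sqrt).inv₀ (Real.sqrt_pos.2 hb0).ne').congr fun m => ?_
    rw [Real.sqrt_div (Nat.cast_nonneg _), inv_div]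
  have h4 := (hν.tendsto _).comp (h3.smul (((hev h2).sub (hev hj)).sub (hln.smul h1)))
  have h5 : windowStat ν b x t
      = ν ((√b)⁻¹ • (x.eval (b + t) - x.eval t - b • x.1 1)) := by
    rw [map_smul_eq_mul, Real.norm_of_nonneg (by positivity), windowStat, div_eq_inv_mul]
  rw [h5]
  exact h4

/-- Deterministic heart of the argument: if the window statistics of a continuous path `x` tie with
`ν (x 1)` only on a null set of times, then the proportions of blocks computed from perturbed
statistics of paths converging to `x` converge to the corresponding proportion of windows. -/
theorem tendsto_proportion {V : Type*} [NormedAddCommGroup V] [NormedSpace ℝ V]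
    {ν : Seminorm ℝ V} (hν : Continuous ν) {b : ℝ} (hb0 : 0 < b) {l : ℕ → ℕ}
    (hl : ∀ᶠ n in atTop, l n ≤ n)
    (hlb : Tendsto (fun n : ℕ => (l n : ℝ) / (n : ℝ)) atTop (𝓝 b))
    {x : SkorokhodSpace V} (hx : Continuous x.1)
    (hties : ∀ᵐ s : ℝ, s ∈ Set.Ioo (0 : ℝ) 1 → ν (x.1 1) ≠ windowStat ν b x ((1 - b) * s))
    {ι : Type*} {L : Filter ι} [L.IsCountablyGenerated]
    {y : ι → SkorokhodSpace V} {ε : ι → ℝ} (hε : Tendsto ε L (𝓝 0))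
    (hxy : ∀ m, SkorokhodClose (ε m) x (y m)) {n : ι → ℕ} (hn : Tendsto n L atTop)
    {a : ι → ℝ} (ha : ∀ m, |a m - ν ((y m).1 1)| ≤ ε m) {β : ι → ℕ → ℝ}
    (hβ : ∀ m, ∀ j < n m - l (n m) + 1,
      |β m j - blockStat ν (n m) (l (n m)) (y m) j| ≤ ε m) :
    Tendsto (fun m => ((n m - l (n m) + 1 : ℕ) : ℝ)⁻¹ *
      ∑ j ∈ Finset.range (n m - l (n m) + 1), if a m ≤ β m j then (1 : ℝ) else 0) L
      (𝓝 (∫ s in (0 : ℝ)..1,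
        if ν (x.1 1) ≤ windowStat ν b x ((1 - b) * s) then (1 : ℝ) else 0)) := by
  set N : ι → ℕ := fun m => n m - l (n m) + 1 with hN
  have hNn : Tendsto (fun m => (N m : ℝ) / n m) L (𝓝 (1 - b)) := by
    have h1 : Tendsto (fun k : ℕ => 1 - (l k : ℝ) / k + 1 / (k : ℝ)) atTop (𝓝 (1 - b + 0)) :=
      (tendsto_const_nhds.sub hlb).add tendsto_one_div_atTop_nhds_zero_nat
    rw [add_zero] at h1
    refine (h1.comp hn).congr' ?_
    filter_upwards [hn.eventually hl, hn.eventually (eventually_gt_atTop 0)] with m h2 h3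
    have h3' : (n m : ℝ) ≠ 0 := by exact_mod_cast h3.ne'
    simp only [hN, Function.comp_apply]
    push_cast [Nat.cast_sub h2]
    field_simp
  have hj : ∀ s : ℝ, 0 ≤ s →
      Tendsto (fun m => ((⌊(N m : ℝ) * s⌋₊ : ℕ) : ℝ) / n m) L (𝓝 ((1 - b) * s)) := by
    intro s hs
    have h1 : Tendsto (fun m => (N m : ℝ) / n m * s) L (𝓝 ((1 - b) * s)) := hNn.mul_const s
    have h2 : Tendsto (fun m => (N m : ℝ) / n m * s - 1 / (n m : ℝ)) L (𝓝 ((1 - b) * s - 0)) :=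
      h1.sub (tendsto_one_div_atTop_nhds_zero_nat.comp hn)
    rw [sub_zero] at h2
    refine tendsto_of_tendsto_of_tendsto_of_le_of_le h2 h1 (fun m => ?_) (fun m => ?_)
    · have h3 := (Nat.lt_floor_add_one ((N m : ℝ) * s)).le
      calc (N m : ℝ) / n m * s - 1 / (n m : ℝ) = ((N m : ℝ) * s - 1) / n m := by ring
        _ ≤ _ := by gcongr; linarith
    · have h3 := Nat.floor_le (mul_nonneg (Nat.cast_nonneg (N m)) hs)
      calc ((⌊(N m : ℝ) * s⌋₊ : ℕ) : ℝ) / n m ≤ ((N m : ℝ) * s) / n m := by gcongr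
        _ = _ := by ring
  have hclose : ∀ {u v : ι → ℝ} {c : ℝ}, (∀ᶠ m in L, |u m - v m| ≤ ε m) → Tendsto v L (𝓝 c) →
      Tendsto u L (𝓝 c) := fun {u v c} h hv => by
    have := hv.add (squeeze_zero_norm' (f := fun m => u m - v m) h hε)
    simpa using this
  have ha' : Tendsto a L (𝓝 (ν (x.1 1))) := hclose (.of_forall ha)
    ((hν.tendsto _).comp (tendsto_eval_of_skorokhodClose hx hε hxy tendsto_const_nhds))
  refine Tendsto.congr (fun m => (average_eq_integral_floor (N m) (Nat.succ_pos _)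
    (fun j => if a m ≤ β m j then (1 : ℝ) else 0)).symm) ?_
  refine intervalIntegral.tendsto_integral_filter_of_dominated_convergence (fun _ => 1)
    (.of_forall fun m => ?_) (.of_forall fun m => .of_forall fun s _ => ?_)
    intervalIntegrable_const ?_
  · have hmeas : Measurable (fun s : ℝ => ⌊(N m : ℝ) * s⌋₊) :=
      Nat.measurable_floor.comp (measurable_const.mul measurable_id)
    exact ((measurable_of_countable fun j : ℕ => if a m ≤ β m j then (1 : ℝ) else 0).comp
      hmeas).aestronglyMeasurable
  · split_ifs <;> simp
  · filter_upwards [hties, Measure.ae_ne volume (1 : ℝ)] with s hs hs1 hsI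
    rw [Set.uIoc_of_le zero_le_one] at hsI
    have hslt : s < 1 := lt_of_le_of_ne hsI.2 hs1
    have hne := hs ⟨hsI.1, hslt⟩
    have hlt : ∀ m, ⌊(N m : ℝ) * s⌋₊ < N m := fun m => by
      have hpos : (0 : ℝ) < N m := by exact_mod_cast Nat.succ_pos _
      rw [Nat.floor_lt (mul_nonneg hpos.le hsI.1.le)]
      nlinarith
    have hβ' : Tendsto (fun m => β m ⌊(N m : ℝ) * s⌋₊) L
        (𝓝 (windowStat ν b x ((1 - b) * s))) :=
      hclose (.of_forall fun m => hβ m _ (hlt m))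
        (tendsto_blockStat hν hb0 hlb hx hε hxy hn (hj s hsI.1.le))
    rcases hne.lt_or_gt with h | h
    · rw [if_pos h.le]
      refine tendsto_nhds_of_eventually_eq ?_
      filter_upwards [ha'.eventually_lt hβ' h] with m hm
      rw [if_pos hm.le]
    · rw [if_neg h.not_ge]
      refine tendsto_nhds_of_eventually_eq ?_
      filter_upwards [hβ'.eventually_lt ha' h] with m hm
      rw [if_neg hm.not_ge]

/-! ### Ties have probability zero under Brownian motion -/

theorem Seminorm.continuous_of_finiteDimensional {V : Type*} [NormedAddCommGroup V]
    [NormedSpace ℝ V] [FiniteDimensional ℝ V] (ν : Seminorm ℝ V) : Continuous ν :=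
  continuousOn_univ.1 (ν.convexOn.continuousOn isOpen_univ)

theorem MeasureTheory.Measure.AbsolutelyContinuous.pi_fin {α : Type*} [MeasurableSpace α] :
    ∀ {n : ℕ} {μ ν : Fin n → Measure α} [∀ i, SigmaFinite (μ i)] [∀ i, SigmaFinite (ν i)],
      (∀ i, μ i ≪ ν i) → Measure.pi μ ≪ Measure.pi ν := by
  intro n
  induction n with
  | zero =>
    intro μ ν _ _ _
    rw [Measure.pi_of_empty, Measure.pi_of_empty]
  | succ n ih =>
    intro μ ν _ _ h
    rw [← ((measurePreserving_piFinSuccAbove μ 0).symm _).map_eq,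
      ← ((measurePreserving_piFinSuccAbove ν 0).symm _).map_eq]
    exact ((h 0).prod (ih fun i => h _)).map (MeasurableEquiv.measurable _)

/-- The spheres of a norm are Lebesgue null, since they lie in the frontiers of the balls, which
are convex. -/
theorem Seminorm.volume_sphere_eq_zero {k : ℕ} (hk : 1 ≤ k) (ν : Seminorm ℝ (Fin k → ℝ))
    (hν : ∀ v, ν v = 0 → v = 0) (r : ℝ) : volume {v | ν v = r} = 0 := by
  have : Nonempty (Fin k) := ⟨⟨0, hk⟩⟩
  rcases le_or_gt r 0 with hr | hr
  · refine measure_mono_null (t := {0}) (fun v hv => ?_) (measure_singleton 0)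
    exact hν v (le_antisymm ((show ν v = r from hv).trans_le hr) (apply_nonneg ν v))
  · have hc : Convex ℝ {v | ν v ≤ r} := by simpa using ν.convexOn.convex_le r
    refine measure_mono_null (fun v hv => ?_) (hc.addHaar_frontier volume)
    have hv' : ν v = r := hv
    refine ⟨subset_closure hv'.le, fun hint => ?_⟩
    -- Slightly dilating an interior point of the ball would leave the ball.
    have hcont : Tendsto (fun c : ℝ => c • v) (𝓝[>] 1) (𝓝 v) := by
      have : Continuous fun c : ℝ => c • v := by fun_prop
      simpa using (this.tendsto 1).mono_left nhdsWithin_le_nhds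
    obtain ⟨c, hc1, hc2⟩ := ((hcont.eventually (isOpen_interior.mem_nhds hint)).and
      self_mem_nhdsWithin).exists
    have h1 : ν (c • v) ≤ r := interior_subset (s := {v | ν v ≤ r}) hc1
    have hc2' : 1 < c := hc2
    rw [map_smul_eq_mul, hv', Real.norm_of_nonneg (by linarith)] at h1
    nlinarith

/-- The endpoint of a Brownian vector is independent of its bridge increments: the two are jointly
Gaussian and uncorrelated. -/
theorem IsBrownianVector.indepFun_bridge {k : ℕ} {Ω : Type*} [MeasurableSpace Ω]
    {W : Fin k → ℝ≥0 → Ω → ℝ} {Q : Measure Ω} [IsProbabilityMeasure Q]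
    (hW : IsBrownianVector W Q) {s t : ℝ≥0} (hst : s ≤ t) (ht : t ≤ 1) :
    IndepFun (fun ω i => W i 1 ω)
      (fun ω i => W i t ω - W i s ω - ((t : ℝ) - s) * W i 1 ω) Q := by
  set c : ℝ := (t : ℝ) - s with hc
  set V : Fin k → Ω → ℝ × ℝ := fun i ω => (W i 1 ω, W i t ω - W i s ω - c * W i 1 ω)
  have hVi : iIndepFun V Q :=
    hW.indep.comp (fun _ f => (f 1, f t - f s - c * f 1)) fun _ => by fun_prop
  have hVg : ∀ i, HasGaussianLaw (V i) Q := fun i => by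
    let J : Finset ℝ≥0 := {1, t, s}
    let p : J → (J → ℝ) →L[ℝ] ℝ := fun a => ContinuousLinearMap.proj a
    exact ((hW.brownian i).hasLaw J).hasGaussianLaw.map_fun
      ((p ⟨1, by simp [J]⟩).prod
        (p ⟨t, by simp [J]⟩ - p ⟨s, by simp [J]⟩ - c • p ⟨1, by simp [J]⟩))
  have hg := (hVi.hasGaussianLaw hVg).map_fun
    ((ContinuousLinearMap.pi fun i => (ContinuousLinearMap.fst ℝ ℝ ℝ).comp
        (ContinuousLinearMap.proj (R := ℝ) (φ := fun _ : Fin k => ℝ × ℝ) i)).prod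
      (ContinuousLinearMap.pi fun i => (ContinuousLinearMap.snd ℝ ℝ ℝ).comp
        (ContinuousLinearMap.proj (R := ℝ) (φ := fun _ : Fin k => ℝ × ℝ) i)))
  refine HasGaussianLaw.indepFun_of_covariance_eval
    (X := fun i ω => W i 1 ω) (Y := fun i ω => W i t ω - W i s ω - c * W i 1 ω) hg fun i j => ?_
  have hL : ∀ i u, MemLp (fun ω => W i u ω) 2 Q := fun i u =>
    ((hW.brownian i).hasLaw_eval u).hasGaussianLaw.memLp_two
  have hL' : MemLp (fun ω => W j t ω - W j s ω) 2 Q := (hL j t).sub (hL j s)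
  rcases eq_or_ne i j with rfl | hij
  · rw [covariance_fun_sub_right (hL i 1) hL' ((hL i 1).const_mul c),
      covariance_fun_sub_right (hL i 1) (hL i t) (hL i s), covariance_const_mul_right]
    simp only [(hW.brownian i).covariance_fun_eval]
    rw [min_eq_right ht, min_eq_right (hst.trans ht), min_self, NNReal.coe_one, hc]
    ring
  · exact ((hVi.indepFun hij).comp measurable_fst measurable_snd).covariance_eq_zero (hL i 1)
      (hL'.sub ((hL j 1).const_mul c))

theorem IsBrownianVector.map_eval_one_absolutelyContinuous {k : ℕ} {Ω : Type*}
    [MeasurableSpace Ω] {W : Fin k → ℝ≥0 → Ω → ℝ} {Q : Measure Ω} [IsProbabilityMeasure Q]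
    (hW : IsBrownianVector W Q) : Q.map (fun ω i => W i 1 ω) ≪ volume := by
  have hm : ∀ i, AEMeasurable (W i 1) Q := fun i => (hW.brownian i).aemeasurable 1
  have hi : iIndepFun (fun i => W i 1) Q := hW.indep.comp (fun _ f => f 1) fun _ => by fun_prop
  rw [(iIndepFun_iff_map_fun_eq_pi_map hm).1 hi, volume_pi]
  have : ∀ i, IsProbabilityMeasure (Q.map (W i 1)) := fun i =>
    Measure.isProbabilityMeasure_map (hm i)
  refine Measure.AbsolutelyContinuous.pi_fin fun i => ?_
  rw [((hW.brownian i).hasLaw_eval 1).map_eq]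
  exact gaussianReal_absolutelyContinuous _ one_ne_zero

/-- Ties between the norm of the endpoint and the scaled norm of a bridge increment have
probability zero: given the bridge increment, the endpoint would have to lie on a sphere. -/
theorem IsBrownianVector.ae_ne_bridge {k : ℕ} (hk : 1 ≤ k) {Ω : Type*} [MeasurableSpace Ω]
    {W : Fin k → ℝ≥0 → Ω → ℝ} {Q : Measure Ω} [IsProbabilityMeasure Q]
    (hW : IsBrownianVector W Q) (ν : Seminorm ℝ (Fin k → ℝ)) (hν : ∀ v, ν v = 0 → v = 0)
    {s t : ℝ≥0} (hst : s ≤ t) (ht : t ≤ 1) (c : ℝ) :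
    ∀ᵐ ω ∂Q, ν (fun i => W i 1 ω)
      ≠ ν (fun i => W i t ω - W i s ω - ((t : ℝ) - s) * W i 1 ω) / c := by
  have hm : ∀ i u, AEMeasurable (W i u) Q := fun i u => (hW.brownian i).aemeasurable u
  set A : Ω → Fin k → ℝ := fun ω i => W i 1 ω
  set B : Ω → Fin k → ℝ := fun ω i => W i t ω - W i s ω - ((t : ℝ) - s) * W i 1 ω
  have hA : AEMeasurable A Q := aemeasurable_pi_lambda _ fun i => hm i 1
  have hB : AEMeasurable B Q := aemeasurable_pi_lambda _ fun i =>
    ((hm i t).sub (hm i s)).sub ((hm i 1).const_mul _)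
  have hνc := ν.continuous_of_finiteDimensional
  have hset : MeasurableSet {p : (Fin k → ℝ) × (Fin k → ℝ) | ν p.1 = ν p.2 / c} :=
    (isClosed_eq (by fun_prop) (by fun_prop)).measurableSet
  have hlaw := (indepFun_iff_map_prod_eq_prod_map_map hA hB).1 (hW.indepFun_bridge hst ht)
  have : IsProbabilityMeasure (Q.map A) := Measure.isProbabilityMeasure_map hA
  have : IsProbabilityMeasure (Q.map B) := Measure.isProbabilityMeasure_map hB
  have h0 : Q.map (fun ω => (A ω, B ω)) {p | ν p.1 = ν p.2 / c} = 0 := by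
    rw [hlaw, Measure.prod_apply_symm hset]
    exact (lintegral_congr fun y => hW.map_eval_one_absolutelyContinuous
      (ν.volume_sphere_eq_zero hk hν (ν y / c))).trans lintegral_zero
  rw [Measure.map_apply_of_aemeasurable (hA.prodMk hB) hset] at h0
  exact measure_eq_zero_iff_ae_notMem.1 h0

/-- Fubini's theorem for a continuous process whose coordinates are only almost everywhere
measurable; passing to the completed measure provides joint measurability. -/
theorem ae_ae_ne_zero_of_continuous {Ω : Type*} [MeasurableSpace Ω] {Q : Measure Ω}
    [IsProbabilityMeasure Q] {f : ℝ → Ω → ℝ} (hc : ∀ ω, Continuous fun s => f s ω)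
    (hm : ∀ s, AEMeasurable (f s) Q) {A : Set ℝ} (hA : MeasurableSet A)
    (h : ∀ s ∈ A, ∀ᵐ ω ∂Q, f s ω ≠ 0) : ∀ᵐ ω ∂Q, ∀ᵐ s : ℝ, s ∈ A → f s ω ≠ 0 := by
  have : IsProbabilityMeasure Q.completion :=
    ⟨(Measure.completion_apply Q Set.univ).trans measure_univ⟩
  have hmeas : Measurable (Function.uncurry fun (s : ℝ) (ω : NullMeasurableSpace Ω Q) => f s ω) :=
    measurable_uncurry_of_continuous_of_measurable hc fun s => (hm s).nullMeasurable
  have hset : MeasurableSet {p : ℝ × NullMeasurableSpace Ω Q | p.1 ∈ A → f p.1 p.2 ≠ 0} := by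
    have h1 : MeasurableSet {p : ℝ × NullMeasurableSpace Ω Q | f p.1 p.2 ≠ 0} :=
      (hmeas (measurableSet_singleton 0)).compl
    exact (measurable_fst hA).imp h1
  rw [← Measure.ae_completion Q]
  refine (Measure.ae_ae_comm (μ := volume) (ν := Q.completion)
    (p := fun s ω => s ∈ A → f s ω ≠ 0) hset).1 (.of_forall fun s => ?_)
  rw [Measure.ae_completion Q]
  by_cases hs : s ∈ A
  · filter_upwards [h s hs] with ω hω _ using hω
  · exact .of_forall fun ω hs' => absurd hs' hs

/-! ### An extended continuous mapping theorem -/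

/-- An extended continuous mapping theorem. If `S n` converges in distribution to `W`, if the pair
`(S n, p n)` satisfies each of the decreasing relations `A m` with probability tending to one, and
if almost surely the relations `A m` pin down the value `G` in the limit at `W`, then `p n`
converges in distribution to `G`. -/
theorem tendstoInDistribution_of_relation {E Ω Ω' : Type*} [TopologicalSpace E]
    [HasOuterApproxClosed E] [MeasurableSpace E] [BorelSpace E] [MeasurableSpace Ω]
    [MeasurableSpace Ω'] {P : Measure Ω} [IsProbabilityMeasure P] {Q : Measure Ω'}
    [IsProbabilityMeasure Q] {S : ℕ → Ω → E} {W : Ω' → E}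
    (hS : TendstoInDistribution S atTop W (fun _ => P) Q) {p : ℕ → Ω → ℝ}
    (hp : ∀ n, AEMeasurable (p n) P) {G : Ω' → ℝ} (hG : AEMeasurable G Q) {A : ℕ → E → ℝ → Prop}
    (hanti : ∀ m x r, A (m + 1) x r → A m x r)
    (hA : ∀ m, Tendsto (fun n => P {ω | ¬ A m (S n ω) (p n ω)}) atTop (𝓝 0))
    (hlim : ∀ᵐ ω ∂Q, ∀ F : Set ℝ, IsClosed F →
      (∀ m, W ω ∈ closure {x | ∃ r ∈ F, A m x r}) → G ω ∈ F) :
    TendstoInDistribution p atTop G (fun _ => P) Q := by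
  refine ⟨hp, hG, tendsto_of_forall_isClosed_limsup_le' fun F hF => ?_⟩
  set C : ℕ → Set E := fun m => closure {x | ∃ r ∈ F, A m x r} with hC
  have hCanti : Antitone C := antitone_nat_of_succ_le fun m =>
    closure_mono fun x ⟨r, hr, h⟩ => ⟨r, hr, hanti m x r h⟩
  have hWC : ∀ m, NullMeasurableSet (W ⁻¹' C m) Q := fun m =>
    hS.aemeasurable_limit.nullMeasurable isClosed_closure.measurableSet
  have hbound : ∀ m, limsup (fun n => P.map (p n) F) atTop ≤ Q (W ⁻¹' C m) := by
    intro m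
    have h1 : limsup (fun n => P.map (S n) (C m)) atTop ≤ Q.map W (C m) :=
      ProbabilityMeasure.limsup_measure_closed_le_of_tendsto hS.tendsto isClosed_closure
    calc limsup (fun n => P.map (p n) F) atTop
        ≤ limsup (fun n => P.map (S n) (C m) + P {ω | ¬ A m (S n ω) (p n ω)}) atTop := by
          refine limsup_le_limsup (.of_forall fun n => ?_)
          simp only
          rw [Measure.map_apply_of_aemeasurable (hp n) hF.measurableSet,
            Measure.map_apply_of_aemeasurable (hS.forall_aemeasurable n)
              isClosed_closure.measurableSet]
          refine (measure_mono fun ω hω => ?_).trans (measure_union_le _ _)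
          by_cases h : A m (S n ω) (p n ω)
          · exact Or.inl (subset_closure ⟨p n ω, hω, h⟩)
          · exact Or.inr h
      _ ≤ Q (W ⁻¹' C m) := by
          refine (ENNReal.limsup_add_of_right_tendsto_zero (hA m) _).trans_le ?_
          exact h1.trans_eq (Measure.map_apply_of_aemeasurable hS.aemeasurable_limit
            isClosed_closure.measurableSet)
  have hInter : Tendsto (fun m => Q (W ⁻¹' C m)) atTop (𝓝 (Q (⋂ m, W ⁻¹' C m))) :=
    tendsto_measure_iInter_atTop hWC (fun _ _ h => Set.preimage_mono (hCanti h))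
      ⟨0, measure_ne_top _ _⟩
  -- The bound by `Q (W ∈ C m)` holds for every `m`, hence also for the intersection.
  refine (ge_of_tendsto' hInter hbound).trans ?_
  change _ ≤ Q.map G F
  rw [Measure.map_apply_of_aemeasurable hG hF.measurableSet]
  refine measure_mono_ae ?_
  filter_upwards [hlim] with ω hω h
  exact hω F hF fun m => Set.mem_iInter.1 h m

/-! ### The limit variable as a functional of the limiting path -/

theorem Matrix.PosDef.sqrt_mulVec_eq_zero {k : ℕ} {S : Matrix (Fin k) (Fin k) ℝ} (hS : S.PosDef)
    {v : Fin k → ℝ} (hv : CFC.sqrt S *ᵥ v = 0) : v = 0 := by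
  have h : S *ᵥ v = 0 := by
    rw [← CFC.sqrt_mul_sqrt_self S hS.posSemidef.nonneg, ← Matrix.mulVec_mulVec, hv,
      Matrix.mulVec_zero]
  exact Matrix.mulVec_injective_of_isUnit hS.isUnit (h.trans (Matrix.mulVec_zero S).symm)

theorem scaledBrownianPath_eval {k : ℕ} {Ω : Type*} (S : Matrix (Fin k) (Fin k) ℝ)
    (W : Fin k → ℝ≥0 → Ω → ℝ) (hW : ∀ i ω, Continuous (fun t => W i t ω)) (ω : Ω) {r : ℝ}
    (hr : r ∈ Set.Icc (0 : ℝ) 1) :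
    (scaledBrownianPath S W hW ω).eval r = CFC.sqrt S *ᵥ fun i => W i r.toNNReal ω := by
  simp only [SkorokhodSpace.eval, scaledBrownianPath, scaledBrownian,
    Set.projIcc_of_mem zero_le_one hr]

theorem continuous_scaledBrownianPath {k : ℕ} {Ω : Type*} (S : Matrix (Fin k) (Fin k) ℝ)
    (W : Fin k → ℝ≥0 → Ω → ℝ) (hW : ∀ i ω, Continuous (fun t => W i t ω)) (ω : Ω) :
    Continuous (scaledBrownianPath S W hW ω).1 := by
  have h : Continuous (fun r : I => fun i => W i (r : ℝ).toNNReal ω) :=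
    continuous_pi fun i => (hW i ω).comp (continuous_real_toNNReal.comp continuous_subtype_val)
  exact Continuous.matrix_mulVec continuous_const h

theorem scaledBrownianPath_one {k : ℕ} {Ω : Type*} (S : Matrix (Fin k) (Fin k) ℝ)
    (W : Fin k → ℝ≥0 → Ω → ℝ) (hW : ∀ i ω, Continuous (fun t => W i t ω)) (ω : Ω) :
    (scaledBrownianPath S W hW ω).1 1 = CFC.sqrt S *ᵥ fun i => W i 1 ω := by
  simp [scaledBrownianPath, scaledBrownian]

theorem windowStat_scaledBrownianPath {k : ℕ} {Ω : Type*} (S : Matrix (Fin k) (Fin k) ℝ)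
    (W : Fin k → ℝ≥0 → Ω → ℝ) (hW : ∀ i ω, Continuous (fun t => W i t ω)) (ω : Ω)
    (ν : Seminorm ℝ (Fin k → ℝ)) {b t : ℝ} (hb : 0 ≤ b) (ht : 0 ≤ t) (hbt : b + t ≤ 1) :
    windowStat ν b (scaledBrownianPath S W hW ω) t
      = ν (CFC.sqrt S *ᵥ (fun i => W i (b + t).toNNReal ω - W i t.toNNReal ω - b * W i 1 ω))
        / √b := by
  have h : (fun i => W i (b + t).toNNReal ω - W i t.toNNReal ω - b * W i 1 ω)
      = (fun i => W i (b + t).toNNReal ω) - (fun i => W i t.toNNReal ω)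
        - b • (fun i => W i 1 ω) := rfl
  rw [windowStat, scaledBrownianPath_eval S W hW ω ⟨by linarith, hbt⟩,
    scaledBrownianPath_eval S W hW ω ⟨ht, by linarith⟩, scaledBrownianPath_one, h,
    Matrix.mulVec_sub, Matrix.mulVec_sub, Matrix.mulVec_smul]

theorem mem_window {b s : ℝ} (hb1 : b ≤ 1) (hs : s ∈ Set.Icc (0 : ℝ) 1) :
    0 ≤ (1 - b) * s ∧ b + (1 - b) * s ≤ 1 :=
  ⟨mul_nonneg (by linarith) hs.1, by nlinarith [hs.2]⟩

theorem gTildeVec_eq_integral {k : ℕ} {Ω : Type*} (S : Matrix (Fin k) (Fin k) ℝ)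
    (W : Fin k → ℝ≥0 → Ω → ℝ) (hW : ∀ i ω, Continuous (fun t => W i t ω)) (ω : Ω)
    (ν : Seminorm ℝ (Fin k → ℝ)) {b : ℝ} (hb0 : 0 ≤ b) (hb1 : b ≤ 1) :
    gTildeVec b S ν W ω = ∫ s in (0 : ℝ)..1,
      if ν ((scaledBrownianPath S W hW ω).1 1)
        ≤ windowStat ν b (scaledBrownianPath S W hW ω) ((1 - b) * s) then (1 : ℝ) else 0 := by
  rw [gTildeVec, blockAverage_eq_integral]
  refine intervalIntegral.integral_congr fun s hs => ?_
  rw [Set.uIcc_of_le zero_le_one] at hs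
  obtain ⟨h1, h2⟩ := mem_window hb1 hs
  simp only [windowStat_scaledBrownianPath S W hW ω ν hb0 h1 h2, scaledBrownianPath_one]

theorem SkorokhodSpace.continuous_eval {E : Type*} [TopologicalSpace E] {w : SkorokhodSpace E}
    (hw : Continuous w.1) : Continuous w.eval :=
  hw.comp continuous_projIcc

theorem aemeasurable_scaledBrownianPath_apply {k : ℕ} {Ω : Type*} [MeasurableSpace Ω]
    {Q : Measure Ω} (S : Matrix (Fin k) (Fin k) ℝ) {W : Fin k → ℝ≥0 → Ω → ℝ}
    (hW : IsBrownianVector W Q) (r : I) :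
    AEMeasurable (fun ω => (scaledBrownianPath S W hW.cont ω).1 r) Q := by
  have h1 : AEMeasurable (fun ω => fun i => W i (r : ℝ).toNNReal ω) Q :=
    aemeasurable_pi_lambda _ fun i => (hW.brownian i).aemeasurable _
  have h2 : Continuous fun v : Fin k → ℝ => CFC.sqrt S *ᵥ v :=
    Continuous.matrix_mulVec continuous_const continuous_id
  exact h2.measurable.comp_aemeasurable h1

/-- Almost every path of `Σ^{1/2} W` has ties at almost no time. -/
theorem ae_scaledBrownianPath_ties {k : ℕ} (hk : 1 ≤ k) {Ω : Type*} [MeasurableSpace Ω]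
    {Q : Measure Ω} [IsProbabilityMeasure Q] {S : Matrix (Fin k) (Fin k) ℝ} (hS : S.PosDef)
    {W : Fin k → ℝ≥0 → Ω → ℝ} (hW : IsBrownianVector W Q) (ν : Seminorm ℝ (Fin k → ℝ))
    (hν : ∀ v, ν v = 0 → v = 0) {b : ℝ} (hb0 : 0 ≤ b) (hb1 : b ≤ 1) :
    ∀ᵐ ω ∂Q, ∀ᵐ s : ℝ, s ∈ Set.Ioo (0 : ℝ) 1 →
      ν ((scaledBrownianPath S W hW.cont ω).1 1)
        ≠ windowStat ν b (scaledBrownianPath S W hW.cont ω) ((1 - b) * s) := by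
  have hνc := ν.continuous_of_finiteDimensional
  have key := ae_ae_ne_zero_of_continuous (Q := Q) (A := Set.Ioo (0 : ℝ) 1)
    (f := fun s ω => ν ((scaledBrownianPath S W hW.cont ω).1 1)
      - windowStat ν b (scaledBrownianPath S W hW.cont ω) ((1 - b) * s)) ?_ ?_ measurableSet_Ioo ?_
  · filter_upwards [key] with ω hω
    filter_upwards [hω] with s hs hsA
    exact sub_ne_zero.1 (hs hsA)
  · intro ω
    have hc := SkorokhodSpace.continuous_eval (continuous_scaledBrownianPath S W hW.cont ω)
    unfold windowStat
    fun_prop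
  · intro s
    have hm := aemeasurable_scaledBrownianPath_apply S hW
    exact (hνc.measurable.comp_aemeasurable (hm 1)).sub
      ((hνc.measurable.comp_aemeasurable (((hm _).sub (hm _)).sub ((hm 1).const_smul b))).div_const
        _)
  · intro s hs
    obtain ⟨h1, h2⟩ := mem_window hb1 (Set.Ioo_subset_Icc_self hs)
    set t := (1 - b) * s
    have h3 : 0 ≤ b + t := by linarith
    filter_upwards [hW.ae_ne_bridge hk (ν.comp (Matrix.mulVecLin (CFC.sqrt S)))
      (fun v hv => hS.sqrt_mulVec_eq_zero (hν _ hv))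
      (s := t.toNNReal) (t := (b + t).toNNReal) (Real.toNNReal_le_toNNReal (by linarith))
      (by simpa using h2) (√b)] with ω hω
    rw [windowStat_scaledBrownianPath S W hW.cont ω ν hb0 h1 h2, scaledBrownianPath_one]
    rw [Real.coe_toNNReal _ h1, Real.coe_toNNReal _ h3, add_sub_cancel_right] at hω
    exact sub_ne_zero.2 hω

theorem aemeasurable_proportion {Ω : Type*} [MeasurableSpace Ω] {P : Measure Ω} {a : Ω → ℝ}
    {β : ℕ → Ω → ℝ} (ha : AEMeasurable a P) (hβ : ∀ j, AEMeasurable (β j) P) (c : ℝ)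
    (s : Finset ℕ) :
    AEMeasurable (fun ω => c * ∑ j ∈ s, if a ω ≤ β j ω then (1 : ℝ) else 0) P := by
  have h : Measurable fun q : ℝ × ℝ => if q.1 ≤ q.2 then (1 : ℝ) else 0 :=
    Measurable.ite (measurableSet_le measurable_fst measurable_snd) measurable_const
      measurable_const
  exact (Finset.aemeasurable_fun_sum s fun j _ =>
    h.comp_aemeasurable (ha.prodMk (hβ j))).const_mul c

/-- The limit variable is measurable as an almost sure limit of proportions over finitely many
blocks of the limiting path. -/
theorem aemeasurable_gTildeVec {k : ℕ} (hk : 1 ≤ k) {Ω : Type*} [MeasurableSpace Ω]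
    {Q : Measure Ω} [IsProbabilityMeasure Q] {S : Matrix (Fin k) (Fin k) ℝ} (hS : S.PosDef)
    {W : Fin k → ℝ≥0 → Ω → ℝ} (hW : IsBrownianVector W Q) (ν : Seminorm ℝ (Fin k → ℝ))
    (hν : ∀ v, ν v = 0 → v = 0) {b : ℝ} (hb0 : 0 < b) (hb1 : b ≤ 1) {l : ℕ → ℕ}
    (hl : ∀ᶠ n in atTop, l n ≤ n)
    (hlb : Tendsto (fun n : ℕ => (l n : ℝ) / (n : ℝ)) atTop (𝓝 b)) :
    AEMeasurable (gTildeVec b S ν W) Q := by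
  have hνc := ν.continuous_of_finiteDimensional
  have hm := aemeasurable_scaledBrownianPath_apply S hW
  refine aemeasurable_of_tendsto_metrizable_ae atTop (f := fun n ω =>
    ((n - l n + 1 : ℕ) : ℝ)⁻¹ * ∑ j ∈ Finset.range (n - l n + 1),
      if ν ((scaledBrownianPath S W hW.cont ω).1 1)
        ≤ blockStat ν n (l n) (scaledBrownianPath S W hW.cont ω) j then (1 : ℝ) else 0)
    (fun n => ?_) ?_
  · refine aemeasurable_proportion (hνc.measurable.comp_aemeasurable (hm 1)) (fun j => ?_) _ _
    exact hνc.measurable.comp_aemeasurable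
      ((((hm _).sub (hm _)).sub ((hm 1).const_smul ((l n : ℝ) / n))).const_smul
        (√(n : ℝ) / √(l n : ℝ)))
  · filter_upwards [ae_scaledBrownianPath_ties hk hS hW ν hν hb0.le hb1] with ω hω
    rw [gTildeVec_eq_integral S W hW.cont ω ν hb0.le hb1]
    refine tendsto_proportion hνc hb0 hl hlb (continuous_scaledBrownianPath S W hW.cont ω) hω
      tendsto_one_div_add_atTop_nhds_zero_nat (fun m => SkorokhodClose.refl (by positivity) _)
      tendsto_id (fun m => ?_) fun m j _ => ?_
    · rw [sub_self, abs_zero]; positivity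
    · simp only [id_eq, sub_self, abs_zero]; positivity

theorem gTildeVec_eq_gTilde {k : ℕ} (hk : k = 1) {Ω : Type*} {S : Matrix (Fin k) (Fin k) ℝ}
    (hS : S.PosDef) (W : Fin k → ℝ≥0 → Ω → ℝ) (ν : Seminorm ℝ (Fin k → ℝ))
    (hν : ∀ v, ν v = 0 → v = 0) (b : ℝ) (i : Fin k) (ω : Ω) :
    gTildeVec b S ν W ω = gTilde b (W i) ω := by
  subst hk
  -- On `ℝ¹` the norm `ν ∘ Σ^{1/2}` is a positive multiple of the absolute value.
  obtain ⟨κ, hκ, hscale⟩ : ∃ κ : ℝ, 0 < κ ∧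
      ∀ v : Fin 1 → ℝ, ν (CFC.sqrt S *ᵥ v) = |v i| * κ := by
    refine ⟨ν (CFC.sqrt S *ᵥ fun _ => 1), lt_of_le_of_ne (apply_nonneg _ _) fun h =>
      one_ne_zero (congr_fun (hS.sqrt_mulVec_eq_zero (hν _ h.symm)) 0), fun v => ?_⟩
    have hv : v = v i • fun _ => (1 : ℝ) := by
      ext j
      simp [Subsingleton.elim j i]
    conv_lhs => rw [hv]
    rw [Matrix.mulVec_smul, map_smul_eq_mul, Real.norm_eq_abs]
  unfold gTildeVec gTilde
  simp only [hscale, mul_div_right_comm, mul_le_mul_iff_left₀ hκ]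

/-! ### The estimators as functionals of the partial sum path -/

theorem partialSumPath_one {k : ℕ} (Y : ℤ → (Fin k → ℝ)) (n : ℕ) :
    (partialSumPath Y n).1 1 = (√(n : ℝ))⁻¹ • ∑ j ∈ Finset.Icc 1 n, Y j := by
  simp [partialSumPath]

theorem partialSumPath_eval {k : ℕ} (Y : ℤ → (Fin k → ℝ)) {n j : ℕ} (hn : 0 < n) (hj : j ≤ n) :
    (partialSumPath Y n).eval ((j : ℝ) / n) = (√(n : ℝ))⁻¹ • ∑ h ∈ Finset.Icc 1 j, Y h := by
  have hn' : (0 : ℝ) < n := by exact_mod_cast hn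
  have hmem : (j : ℝ) / n ∈ Set.Icc (0 : ℝ) 1 :=
    ⟨by positivity, (div_le_one hn').2 (by exact_mod_cast hj)⟩
  simp only [SkorokhodSpace.eval, partialSumPath, Set.projIcc_of_mem zero_le_one hmem,
    mul_div_cancel₀ (j : ℝ) hn'.ne', Nat.floor_natCast]

section Expansion

variable {E : Type*} [MeasurableSpace E] {k : ℕ} (T : Measure E → (Fin k → ℝ)) (F : Measure E)
  (x : ℤ → E)

/-- Under the null hypothesis the left-hand side is the full-sample statistic. -/
theorem sqrt_smul_estimate_sub (n : ℕ) :
    √(n : ℝ) • (T (blockEmpirical x 1 n) - T F)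
      = (partialSumPath (fun h => influenceFunction T F (x h)) n).1 1
        + √(n : ℝ) • remainder T F x 1 n := by
  have hI : Finset.Ico 1 (1 + n) = Finset.Icc 1 n := by ext; simp; omega
  rw [partialSumPath_one, remainder, hI, smul_sub (√(n : ℝ)) (T (blockEmpirical x 1 n) - T F),
    smul_smul, ← div_eq_mul_inv, Real.sqrt_div_self]
  abel

theorem sqrt_smul_block_sub {n l j : ℕ} (hn : 0 < n) (hl : 0 < l) (hj : j + l ≤ n) :
    √(l : ℝ) • (T (blockEmpirical x (j + 1) l) - T (blockEmpirical x 1 n))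
      = (√(n : ℝ) / √(l : ℝ)) •
          ((partialSumPath (fun h => influenceFunction T F (x h)) n).eval (((j + l : ℕ) : ℝ) / n)
            - (partialSumPath (fun h => influenceFunction T F (x h)) n).eval ((j : ℝ) / n)
            - ((l : ℝ) / n) • (partialSumPath (fun h => influenceFunction T F (x h)) n).1 1)
        + (√(l : ℝ) • remainder T F x (j + 1) l - √(l : ℝ) • remainder T F x 1 n) := by
  have hI : Finset.Ico 1 (1 + n) = Finset.Icc 1 n := by ext; simp; omega
  have hblock : ∑ h ∈ Finset.Ico (j + 1) (j + 1 + l), influenceFunction T F (x (h : ℤ))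
      = ∑ h ∈ Finset.Icc 1 (j + l), influenceFunction T F (x (h : ℤ))
        - ∑ h ∈ Finset.Icc 1 j, influenceFunction T F (x (h : ℤ)) := by
    have hIcc : ∀ q, Finset.Icc 1 q = Finset.Ico 1 (q + 1) := fun q => by ext; simp
    rw [hIcc, hIcc, eq_sub_iff_add_eq', add_right_comm j 1 l]
    exact Finset.sum_Ico_consecutive _ (by omega) (by omega)
  rw [partialSumPath_eval _ hn hj, partialSumPath_eval _ hn (by omega), partialSumPath_one,
    remainder, remainder, hI, hblock]
  have hn' : (0 : ℝ) < √(n : ℝ) := Real.sqrt_pos.2 (by exact_mod_cast hn)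
  have hl' : (0 : ℝ) < √(l : ℝ) := Real.sqrt_pos.2 (by exact_mod_cast hl)
  have hn2 : (n : ℝ) = √(n : ℝ) * √(n : ℝ) := (Real.mul_self_sqrt (Nat.cast_nonneg n)).symm
  have hl2 : (l : ℝ) = √(l : ℝ) * √(l : ℝ) := (Real.mul_self_sqrt (Nat.cast_nonneg l)).symm
  ext i
  simp only [Pi.smul_apply, Pi.sub_apply, Pi.add_apply, smul_eq_mul]
  generalize √(n : ℝ) = u at *
  generalize √(l : ℝ) = v at *
  rw [hn2, hl2]
  field_simp
  ring

theorem abs_estimate_sub_le (ν : Seminorm ℝ (Fin k → ℝ)) (n : ℕ) :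
    |ν (√(n : ℝ) • (T (blockEmpirical x 1 n) - T F))
        - ν ((partialSumPath (fun h => influenceFunction T F (x h)) n).1 1)|
      ≤ √(n : ℝ) * ν (remainder T F x 1 n) := by
  refine (abs_sub_map_le_sub ν _ _).trans_eq ?_
  rw [sqrt_smul_estimate_sub, add_sub_cancel_left, map_smul_eq_mul,
    Real.norm_of_nonneg (Real.sqrt_nonneg _)]

theorem abs_block_sub_blockStat_le (ν : Seminorm ℝ (Fin k → ℝ)) {n l j : ℕ} (hn : 0 < n)
    (hl : 0 < l) (hj : j + l ≤ n) :
    |ν (√(l : ℝ) • (T (blockEmpirical x (j + 1) l) - T (blockEmpirical x 1 n)))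
        - blockStat ν n l (partialSumPath (fun h => influenceFunction T F (x h)) n) j|
      ≤ √(l : ℝ) * ν (remainder T F x (j + 1) l) + √(n : ℝ) * ν (remainder T F x 1 n) := by
  have hln : √(l : ℝ) ≤ √(n : ℝ) := Real.sqrt_le_sqrt (by exact_mod_cast (by omega : l ≤ n))
  rw [blockStat, sqrt_smul_block_sub T F x hn hl hj]
  refine (abs_sub_map_le_sub ν _ _).trans ?_
  rw [add_sub_cancel_left]
  refine (map_sub_le_add ν _ _).trans ?_
  rw [map_smul_eq_mul, map_smul_eq_mul, Real.norm_of_nonneg (Real.sqrt_nonneg _)]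
  have := mul_le_mul_of_nonneg_right hln (apply_nonneg ν (remainder T F x 1 n))
  linarith

theorem subsamplingPValue_eq (ν : Seminorm ℝ (Fin k → ℝ)) (θ₀ : Fin k → ℝ) (n l : ℕ) :
    subsamplingPValue ν T θ₀ x n l = ((n - l + 1 : ℕ) : ℝ)⁻¹ *
      ∑ j ∈ Finset.range (n - l + 1),
        if ν (√(n : ℝ) • (T (blockEmpirical x 1 n) - θ₀))
          ≤ ν (√(l : ℝ) • (T (blockEmpirical x (j + 1) l) - T (blockEmpirical x 1 n)))
        then (1 : ℝ) else 0 := by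
  have hI : Finset.Icc 1 (n - l + 1) = Finset.Ico (0 + 1) (n - l + 1 + 1) := by
    ext; simp
  rw [subsamplingPValue, hI, ← Finset.sum_Ico_add', ← Finset.range_eq_Ico]

end Expansion

/-! ### Convergence of the p-value -/

/-- `r` is a proportion of blocks obtained from the path `w` for some sample size `n ≥ m`, up to
errors of size `1 / (m + 1)` in the statistics that are compared. -/
def IsPerturbedProportion {k : ℕ} (ν : Seminorm ℝ (Fin k → ℝ)) (l : ℕ → ℕ) (m : ℕ)
    (w : SkorokhodSpace (Fin k → ℝ)) (r : ℝ) : Prop :=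
  ∃ n ≥ m, ∃ (a : ℝ) (β : ℕ → ℝ), |a - ν (w.1 1)| ≤ 1 / ((m : ℝ) + 1) ∧
    (∀ j < n - l n + 1, |β j - blockStat ν n (l n) w j| ≤ 1 / ((m : ℝ) + 1)) ∧
    r = ((n - l n + 1 : ℕ) : ℝ)⁻¹ *
      ∑ j ∈ Finset.range (n - l n + 1), if a ≤ β j then (1 : ℝ) else 0

theorem IsPerturbedProportion.of_succ {k : ℕ} {ν : Seminorm ℝ (Fin k → ℝ)} {l : ℕ → ℕ} {m : ℕ}
    {w : SkorokhodSpace (Fin k → ℝ)} {r : ℝ} (h : IsPerturbedProportion ν l (m + 1) w r) :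
    IsPerturbedProportion ν l m w r := by
  obtain ⟨n, hn, a, β, ha, hβ, hr⟩ := h
  have hle : 1 / (((m + 1 : ℕ) : ℝ) + 1) ≤ 1 / ((m : ℝ) + 1) := by
    gcongr
    simp
  exact ⟨n, by omega, a, β, ha.trans hle, fun j hj => (hβ j hj).trans hle, hr⟩

/-- At a continuous path whose ties form a null set, the perturbed proportions pin down the
proportion of windows. -/
theorem integral_mem_of_mem_closure {k : ℕ} (ν : Seminorm ℝ (Fin k → ℝ)) {b : ℝ} (hb0 : 0 < b)
    {l : ℕ → ℕ} (hl : ∀ᶠ n in atTop, l n ≤ n)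
    (hlb : Tendsto (fun n : ℕ => (l n : ℝ) / (n : ℝ)) atTop (𝓝 b))
    {x : SkorokhodSpace (Fin k → ℝ)} (hx : Continuous x.1)
    (hties : ∀ᵐ s : ℝ, s ∈ Set.Ioo (0 : ℝ) 1 → ν (x.1 1) ≠ windowStat ν b x ((1 - b) * s))
    {C : Set ℝ} (hC : IsClosed C)
    (hmem : ∀ m, x ∈ closure {w | ∃ r ∈ C, IsPerturbedProportion ν l m w r}) :
    (∫ s in (0 : ℝ)..1,
      if ν (x.1 1) ≤ windowStat ν b x ((1 - b) * s) then (1 : ℝ) else 0) ∈ C := by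
  have h := fun m : ℕ => (mem_closure_iff_nhds_basis (skorokhod_nhds_basis x)).1 (hmem m)
    (1 / ((m : ℝ) + 1)) (by positivity)
  choose y hy hxy using h
  choose r hrC n hnm a β ha hβ hr using hy
  refine hC.mem_of_tendsto (tendsto_proportion ν.continuous_of_finiteDimensional hb0 hl hlb hx
    hties tendsto_one_div_add_atTop_nhds_zero_nat hxy
    (tendsto_atTop_mono hnm tendsto_id) ha hβ) (.of_forall fun m => ?_)
  rw [← hr m]
  exact hrC m

theorem theorem1 {p k : ℕ} (hk : 1 ≤ k)
    {Ω : Type*} [MeasurableSpace Ω] (P : Measure Ω) [IsProbabilityMeasure P]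
    -- a stationary sequence in `ℝᵖ` with marginal distribution `F`
    (X : ℤ → Ω → (Fin p → ℝ)) (hX : ∀ t, Measurable (X t)) (hstat : IsStationarySeq X P)
    (F : Measure (Fin p → ℝ)) (hF : F = P.map (X 1))
    -- a functional with values in `ℝᵏ` whose plug-in estimators are random vectors
    (T : Measure (Fin p → ℝ) → (Fin k → ℝ))
    (hT : ∀ j l : ℕ, AEMeasurable (fun ω => T (blockEmpirical (fun t => X t ω) j l)) P)
    -- the influence function exists
    (hIF : ∀ᵐ x ∂F, ∃ v, Tendsto (contaminationQuotient T F x) (𝓝[>] (0 : ℝ)) (𝓝 v))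
    -- an arbitrary norm on `ℝᵏ`
    (ν : Seminorm ℝ (Fin k → ℝ)) (hν : ∀ v, ν v = 0 → v = 0)
    -- the null hypothesis
    (θ₀ : Fin k → ℝ) (hnull : T F = θ₀)
    -- the block lengths
    (b : ℝ) (hb0 : 0 < b) (hb1 : b ≤ 1) (l : ℕ → ℕ) (hl : ∀ᶠ n in atTop, l n ≤ n)
    (hlb : Tendsto (fun n : ℕ => (l n : ℝ) / (n : ℝ)) atTop (𝓝 b))
    -- the matrix and the Brownian motions of the limit
    (S : Matrix (Fin k) (Fin k) ℝ) (hS : S.PosDef)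
    {Ω' : Type*} [MeasurableSpace Ω'] (Q : Measure Ω') [IsProbabilityMeasure Q]
    (W : Fin k → ℝ≥0 → Ω' → ℝ) (hW : IsBrownianVector W Q)
    -- (A.1)
    (hint : ∀ j : ℤ, Integrable (fun ω => influenceFunction T F (X j ω)) P)
    (hmean : ∀ j : ℤ, ∫ ω, influenceFunction T F (X j ω) ∂P = 0)
    (hclt : TendstoInDistribution
      (fun (n : ℕ) ω => partialSumPath (fun j => influenceFunction T F (X j ω)) n) atTop
      (scaledBrownianPath S W hW.cont) (fun _ => P) Q)
    -- (A.2)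
    (hR : TendstoInMeasure P
      (fun (n : ℕ) ω => Real.sqrt n * ν (remainder T F (fun t => X t ω) 1 n)) atTop
      (fun _ => (0 : ℝ)))
    (hRsup : TendstoInMeasure P
      (fun (n : ℕ) ω => Real.sqrt (l n) *
        ⨆ j : Finset.Icc 1 (n - l n + 1), ν (remainder T F (fun t => X t ω) j (l n))) atTop
      (fun _ => (0 : ℝ))) :
    TendstoInDistribution
      (fun (n : ℕ) ω => subsamplingPValue ν T θ₀ (fun t => X t ω) n (l n)) atTop
      (gTildeVec b S ν W) (fun _ => P) Q ∧
    (k = 1 → ∀ (i : Fin k) (ω : Ω'), gTildeVec b S ν W ω = gTilde b (W i) ω) := by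
  refine ⟨?_, fun hk1 i ω => gTildeVec_eq_gTilde hk1 hS W ν hν b i ω⟩
  subst hnull
  have hνc := ν.continuous_of_finiteDimensional
  refine tendstoInDistribution_of_relation hclt (A := IsPerturbedProportion ν l) (fun n => ?_)
    (aemeasurable_gTildeVec hk hS hW ν hν hb0 hb1 hl hlb) (fun m w r h => h.of_succ)
    (fun m => ?_) ?_
  · simp_rw [subsamplingPValue_eq]
    exact aemeasurable_proportion
      (hνc.measurable.comp_aemeasurable (((hT 1 n).sub_const _).const_smul √(n : ℝ)))
      (fun j => hνc.measurable.comp_aemeasurable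
        (((hT (j + 1) (l n)).sub (hT 1 n)).const_smul √(l n : ℝ))) _ _
  · -- Half of the tolerance, since a block statistic is perturbed by two remainders.
    set δ : ℝ := 1 / ((m : ℝ) + 1) / 2 with hδ
    have hδ0 : 0 < δ := by positivity
    have h1 := tendstoInMeasure_iff_norm.1 hR δ hδ0
    have h2 := tendstoInMeasure_iff_norm.1 hRsup δ hδ0
    have h3 := h1.add h2
    rw [add_zero] at h3
    refine tendsto_of_tendsto_of_tendsto_of_le_of_le' tendsto_const_nhds h3
      (.of_forall fun _ => zero_le) ?_
    filter_upwards [hl, hlb.eventually (lt_mem_nhds hb0), eventually_ge_atTop m,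
      eventually_gt_atTop 0] with n hln hlpos hnm hn
    have hl0 : 0 < l n := by
      rcases Nat.eq_zero_or_pos (l n) with h | h
      · simp [h] at hlpos
      · exact h
    refine (measure_mono fun ω hω => ?_).trans (measure_union_le _ _)
    by_contra hcon
    simp only [Set.mem_union, Set.mem_ofPred_eq, not_or, not_le, sub_zero, Real.norm_eq_abs]
      at hcon
    have hc1 := (le_abs_self _).trans_lt hcon.1
    have hc2 := (le_abs_self _).trans_lt hcon.2
    have hδ2 : 1 / ((m : ℝ) + 1) = δ + δ := by rw [hδ]; ring
    refine hω ⟨n, hnm, _, fun j => _, ?_, fun j hj => ?_, subsamplingPValue_eq T _ ν _ n (l n)⟩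
    · refine (abs_estimate_sub_le T F _ ν n).trans ?_
      linarith
    · refine (abs_block_sub_blockStat_le T F _ ν hn hl0 (by omega)).trans ?_
      have hsup := mul_le_mul_of_nonneg_left (le_ciSup (f := fun i : Finset.Icc 1 (n - l n + 1) =>
        ν (remainder T F (fun t => X t ω) i (l n))) (Set.finite_range _).bddAbove
        ⟨j + 1, Finset.mem_Icc.2 (by omega)⟩) (Real.sqrt_nonneg (l n : ℝ))
      simp only at hsup
      linarith
  · filter_upwards [ae_scaledBrownianPath_ties hk hS hW ν hν hb0.le hb1] with ω hω C hC hmem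
    rw [gTildeVec_eq_integral S W hW.cont ω ν hb0.le hb1]
    exact integral_mem_of_mem_closure ν hb0 hl hlb (continuous_scaledBrownianPath S W hW.cont ω)
      hω hC hmem
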